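/- Let $X$ be a real vector space (of arbitrary, possibly infinite dimension, with no topology), let $Q\subseteq X$ be convex, and let $F\subseteq Q$ with $F\neq\varnothing$ and $F\neq Q$. The following statements are equivalent. (a) $F$ is a proper face of $Q$, i.e. $F$ is a nonempty convex subset of $Q$, $F\ne Q$, and whenever $u,v\in Q$ and $\alpha u+(1-\alpha)v\in F$ for some $\alpha\in(0,1)$, then $u,v\in F$. (b) There exist an affine manifold (affine subspace) $M\subseteq X$ and a generalized semispace $S$ generated by $M$, i.e. a maximal (by inclusion) convex subset of $X\setminus M$, such that $Q\subseteq S\cup M$ and $F=Q\cap M$. (c) There exists a total preorder $\preceq$ on $X$ which is compatible with the algebraic operations (that is, $x\preceq y$ implies $x+z\preceq y+z$ for all $z\in X$ and $\lambda x\preceq\lambda y$ for all $\lambda>0$) such that $F=\mathrm{Min}(Q\mid\preceq):=\{x\in Q : x\preceq y \text{ for all } y\in Q\}$. (d) There exists a regular step-affine function $u:X\to\mathbb R$ such that $u(x)\ge 0$ for all $x\in Q$ and $F=\{x\in Q : u(x)=0\}$. Here a *cortege of affine functions* on $X$ is a set $\mathcal F$ of affine functions $X\to\mathbb R$ together with a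 linear order $\preccurlyeq$ on $\mathcal F$ such that: for every $f\in\mathcal F$ the set $E_f:=\{x\in X : g(x)=0 \text{ for all } g\in\mathcal F \text{ with } g\preccurlyeq f,\ g\neq f\}$ is nonempty and $f(E_f)=\mathbb R$; and for every $x\in X$ the set $\mathcal F_x:=\{f\in\mathcal F : f(x)\ne 0\}$ is either empty or has a least element $f_x$. A function $u:X\to\mathbb R$ is *step-affine* if there is a cortege $\mathcal F$ such that, for all $x\in X$, $u(x)=0$ when $\mathcal F_x=\varnothing$ and $u(x)=f_x(x)$ when $\mathcal F_x\neq\varnothing$; it is *regular* if $u(x)=0$ for at least one $x\in X$. -/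

import Mathlib

namespace ConvexFace

variable {X : Type*} [AddCommGroup X] [Module ℝ X]

/-- `F` is a (nonempty) face of the convex set `Q`. -/
structure IsFace (Q F : Set X) : Prop where
  nonempty : F.Nonempty
  convex : Convex ℝ F
  subset : F ⊆ Q
  extreme : ∀ u ∈ Q, ∀ v ∈ Q, ∀ α : ℝ, 0 < α → α < 1 →
    α • u + (1 - α) • v ∈ F → u ∈ F ∧ v ∈ F

/-- A proper face of `Q`: a nonempty face different from `Q`. -/
def IsProperFace (Q F : Set X) : Prop :=
  IsFace Q F ∧ F ≠ Q

/-- `S` is a generalized semispace generated by the affine manifold `M`: a maximal (by inclusion)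
convex set contained in the complement of `M`. -/
def IsGeneralizedSemispace (M : AffineSubspace ℝ X) (S : Set X) : Prop :=
  Maximal (fun C : Set X => Convex ℝ C ∧ C ⊆ (M : Set X)ᶜ) S

/-- `r` (read `r x y` as `x ⪯ y`) is a total preorder on `X` compatible with the algebraic
operations of `X`. -/
structure IsCompatibleTotalPreorder (r : X → X → Prop) : Prop where
  refl : ∀ x, r x x
  trans : ∀ x y z, r x y → r y z → r x z
  add_right : ∀ x y z, r x y → r (x + z) (y + z)
  smul : ∀ x y, ∀ c : ℝ, 0 < c → r x y → r (c • x) (c • y)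
  total : ∀ x y, r x y ∨ r y x

/-- `Min(Q | ⪯)`: the elements of `Q` that precede all elements of `Q`. -/
def minSet (Q : Set X) (r : X → X → Prop) : Set X :=
  {x | x ∈ Q ∧ ∀ y ∈ Q, r x y}

/-- The set `E_f` of common zeros of the members of the family that strictly precede `f`
(all of `X` if `f` is the first member). -/
def precedingZeros (𝓕 : Set (X →ᵃ[ℝ] ℝ)) (le : 𝓕 → 𝓕 → Prop) (f : 𝓕) : Set X :=
  {x | ∀ g : 𝓕, le g f → g ≠ f → (g : X →ᵃ[ℝ] ℝ) x = 0}

/-- `f` is the least element of `𝓕_x = {f ∈ 𝓕 | f x ≠ 0}`. -/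
def IsLeastNonzeroAt (𝓕 : Set (X →ᵃ[ℝ] ℝ)) (le : 𝓕 → 𝓕 → Prop) (x : X) (f : 𝓕) : Prop :=
  (f : X →ᵃ[ℝ] ℝ) x ≠ 0 ∧ ∀ g : 𝓕, (g : X →ᵃ[ℝ] ℝ) x ≠ 0 → le f g

/-- The family `𝓕` of affine functions on `X`, with the order relation `le` on it, is a cortege
of affine functions. -/
structure IsCortege (𝓕 : Set (X →ᵃ[ℝ] ℝ)) (le : 𝓕 → 𝓕 → Prop) : Prop where
  le_refl : ∀ f, le f f
  le_trans : ∀ f g h, le f g → le g h → le f h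
  le_antisymm : ∀ f g, le f g → le g f → f = g
  le_total : ∀ f g, le f g ∨ le g f
  precedingZeros_nonempty : ∀ f, (precedingZeros 𝓕 le f).Nonempty
  image_precedingZeros : ∀ f : 𝓕, (f : X →ᵃ[ℝ] ℝ) '' precedingZeros 𝓕 le f = Set.univ
  exists_least : ∀ x, (∃ f : 𝓕, (f : X →ᵃ[ℝ] ℝ) x ≠ 0) → ∃ f, IsLeastNonzeroAt 𝓕 le x f

/-- `u` is step-affine: for some cortege `𝓕`, `u x = 0` if all members of `𝓕` vanish at `x`, and
otherwise `u x = f_x x`, where `f_x` is the first member of `𝓕` that does not vanish at `x`. -/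
def IsStepAffine (u : X → ℝ) : Prop :=
  ∃ (𝓕 : Set (X →ᵃ[ℝ] ℝ)) (le : 𝓕 → 𝓕 → Prop), IsCortege 𝓕 le ∧
    ∀ x, ((∀ f : 𝓕, (f : X →ᵃ[ℝ] ℝ) x = 0) → u x = 0) ∧
      ∀ f : 𝓕, IsLeastNonzeroAt 𝓕 le x f → u x = (f : X →ᵃ[ℝ] ℝ) x

/-- A step-affine function is regular if it vanishes somewhere. -/
def IsRegularStepAffine (u : X → ℝ) : Prop :=
  IsStepAffine u ∧ ∃ x, u x = 0

end ConvexFace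

/-! Let `F` be a face, `x₀ ∈ F`, and let `π` be the quotient map of `X` by the direction of `F`. A
point of `Q` in the affine span of `F` already lies in `F`, so `0` is an extreme point of `π (Q -
x₀)`. The cone over this set is then salient, and Zorn's lemma enlarges it to the positive cone of a
linear order on the quotient (`IsFace.exists_linearOrder_quotient`). This order yields the other
three descriptions: the semispace `0 < π (x - x₀)`, the preorder pulled back along `π`, and the
leading coefficient of `π (x - x₀)` under Hahn's embedding into lexicographically ordered series,
whose coefficients form a cortege.

Conversely, each description forbids a segment of `Q` with an interior point in `F` from having an
endpoint outside `F`. -/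

namespace ConvexFace

open HahnSeries

/-! ### Linear orders on real vector spaces -/

section OrderedSpace

variable {V : Type*} [AddCommGroup V] [Module ℝ V]

/-- A monotone additive map from an ordered real vector space to `ℝ` is homogeneous. -/
theorem map_smul_of_monotone [LinearOrder V] [IsOrderedAddMonoid V] [IsOrderedModule ℝ V]
    (f : V →+ ℝ) (hf : Monotone f) (c : ℝ) (x : V) : f (c • x) = c • f x := by
  wlog hx : 0 ≤ x generalizing x
  · have := this (-x) (by simpa using (not_le.1 hx).le)
    simpa using this
  -- On the line through `x` the map is a monotone, hence measurable, additive function of one real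
  -- variable, and so it is continuous and linear.
  let g : ℝ →+ ℝ := f.comp ((LinearMap.toSpanSingleton ℝ V x).toAddMonoidHom)
  have hg : Monotone g := fun a b hab => hf (smul_le_smul_of_nonneg_right hab hx)
  have := map_real_smul g (MeasureTheory.Measure.AddMonoidHom.continuous_of_measurable g hg.measurable) c 1
  simpa [g] using this

/-- Each stratum is Archimedean, so Hölder's theorem embeds it in `ℝ` as an ordered group, and
monotonicity makes the embedding linear. This is the input of Hahn's embedding theorem. -/
theorem nonempty_seed_real [LinearOrder V] [IsOrderedAddMonoid V] [IsOrderedModule ℝ V] :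
    Nonempty (HahnEmbedding.Seed ℝ V ℝ) := by
  obtain ⟨strata⟩ : Nonempty (HahnEmbedding.ArchimedeanStrata ℝ V) := inferInstance
  choose f hf using fun c ↦ Archimedean.exists_orderAddMonoidHom_real_injective (strata.stratum c)
  have hmono (c) : Monotone (f c : strata.stratum c →+ ℝ) := (f c).monotone'
  have : ∀ c, IsOrderedModule ℝ (strata.stratum c) := fun c =>
    { smul_le_smul_of_nonneg_left := fun a ha b b' h =>
        smul_le_smul_of_nonneg_left (β := V) h ha
      smul_le_smul_of_nonneg_right := fun b hb a a' h =>
        smul_le_smul_of_nonneg_right (β := V) h hb }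
  exact ⟨strata,
    fun c ↦ { (f c : strata.stratum c →+ ℝ) with map_smul' := map_smul_of_monotone _ (hmono c) },
    fun c ↦ (hmono c).strictMono_of_injective (hf c)⟩

/-- Every salient pointed cone is contained in a total one. -/
theorem exists_total_cone (C : PointedCone ℝ V) (hC : ∀ x ∈ C, -x ∈ C → x = 0) :
    ∃ D : PointedCone ℝ V, C ≤ D ∧ (∀ x ∈ D, -x ∈ D → x = 0) ∧ ∀ x, x ∈ D ∨ -x ∈ D := by
  obtain ⟨D, hCD, hD, hmax⟩ := zorn_le_nonempty₀
    {D : PointedCone ℝ V | ∀ x ∈ D, -x ∈ D → x = 0} (by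
      intro c hc hchain y hy
      refine ⟨sSup c, fun x hx hx' => ?_, fun z hz => le_sSup hz⟩
      rw [Submodule.mem_sSup_of_directed ⟨y, hy⟩ hchain.directedOn] at hx hx'
      obtain ⟨A, hA, hxA⟩ := hx
      obtain ⟨B, hB, hxB⟩ := hx'
      rcases hchain.total hA hB with h | h
      · exact hc hB x (h hxA) hxB
      · exact hc hA x hxA (h hxB)) C hC
  refine ⟨D, hCD, hD, fun x => or_iff_not_imp_right.2 fun hx => ?_⟩
  have hle : D ≤ D ⊔ PointedCone.hull ℝ {x} := le_sup_left
  refine hmax (y := D ⊔ PointedCone.hull ℝ {x}) ?_ hle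
    (Submodule.mem_sup_right (PointedCone.subset_hull rfl))
  intro y hy hy'
  obtain ⟨p, hp, q, hq, rfl⟩ := Submodule.mem_sup.1 hy
  obtain ⟨p', hp', q', hq', hsum⟩ := Submodule.mem_sup.1 hy'
  obtain ⟨s, rfl⟩ := Submodule.mem_span_singleton.1 hq
  obtain ⟨s', rfl⟩ := Submodule.mem_span_singleton.1 hq'
  -- Adding the expressions of `y` and `-y` puts a multiple of `-x` in `D`. Since `s, s' ≥ 0`,
  -- either both vanish and `D` is salient, or `-x ∈ D`.
  have key : (s + s') • (-x) = p + p' := by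
    rw [smul_neg, add_smul]
    have h : p + p' + (s • x + s' • x) = 0 := by rw [add_add_add_comm, hsum, add_neg_cancel]
    exact (eq_neg_of_add_eq_zero_left h).symm
  by_cases h0 : s + s' = 0
  · have hs : s = 0 := by
      exact (add_eq_zero.1 h0).1
    have hs' : s' = 0 := (add_eq_zero.1 h0).2
    subst hs hs'
    simp only [zero_smul, add_zero] at hsum ⊢
    exact hD p hp (hsum ▸ hp')
  · refine absurd ?_ hx
    have := Submodule.smul_mem D (s + s')⁻¹ (key ▸ D.add_mem hp hp')
    rwa [inv_smul_smul₀ h0] at this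

/-- If the origin is an extreme point of a convex set, then some linear order of the vector space
makes the set nonnegative. -/
theorem exists_linearOrder_of_zero_mem_extremePoints {A : Set V} (hA : Convex ℝ A)
    (h0 : (0 : V) ∈ A.extremePoints ℝ) :
    ∃ (_ : LinearOrder V) (_ : IsOrderedAddMonoid V) (_ : IsOrderedModule ℝ V),
      ∀ a ∈ A, 0 ≤ a := by
  classical
  let C : PointedCone ℝ V := (ConvexCone.hull ℝ A).toPointedCone (ConvexCone.subset_hull h0.1)
  have hAC : A ⊆ C := ConvexCone.subset_hull
  have hsal : ∀ x ∈ C, -x ∈ C → x = 0 := by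
    intro x hx hx'
    obtain ⟨r, hr, a, ha, rfl⟩ := (ConvexCone.mem_hull_of_convex hA).1 hx
    obtain ⟨s, hs, b, hb, hsum⟩ := (ConvexCone.mem_hull_of_convex hA).1 hx'
    dsimp only at hsum ⊢
    have hrs : 0 < r + s := add_pos hr hs
    -- Dividing `r • a + s • b = 0` by `r + s` places the origin inside the segment from `a` to `b`.
    have : a = 0 := h0.2 ha hb ⟨r / (r + s), s / (r + s), by positivity, by positivity,
      by field_simp, by
        rw [div_eq_inv_mul, div_eq_inv_mul, mul_smul, mul_smul, ← smul_add, hsum,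
          add_neg_cancel, smul_zero]⟩
    rw [this, smul_zero]
  obtain ⟨D, hCD, hD, htot⟩ := exists_total_cone _ hsal
  let G : AddGroupCone V :=
    { D.toAddSubmonoid with eq_zero_of_mem_of_neg_mem' := fun {a} h h' => hD a h h' }
  have hG : HasMemOrNegMem G := ⟨htot⟩
  let o : LinearOrder V := LinearOrder.mkOfAddGroupCone G
  have hle : ∀ {a b : V}, a ≤ b ↔ b - a ∈ D := Iff.rfl
  have hmon : IsOrderedAddMonoid V := IsOrderedAddMonoid.mkOfCone G
  refine ⟨o, hmon, ?_, fun a ha => ?_⟩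
  · refine IsOrderedModule.of_smul_nonneg ?_
    intro c hc a ha
    rw [hle, sub_zero] at ha ⊢
    exact D.smul_mem hc ha
  · rw [hle, sub_zero]
    exact hCD (hAC ha)

end OrderedSpace

/-! ### Corteges and Hahn series -/

section Cortege

variable {X : Type*} [AddCommGroup X] [Module ℝ X] {Γ : Type*} [LinearOrder Γ]

/-- An injective family of affine functions, ordered as its index set, is a cortege if all its
members vanish at a common point, each member is the first nonvanishing one at some point, and the
first nonvanishing member exists at every point where not all members vanish. -/
theorem isCortege_range {f : Γ → X →ᵃ[ℝ] ℝ} (hf : Function.Injective f) (x₀ : X)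
    (hx₀ : ∀ c, f c x₀ = 0) (hfirst : ∀ c, ∃ y, f c y ≠ 0 ∧ ∀ d < c, f d y = 0)
    (hleast : ∀ x, (∃ c, f c x ≠ 0) → ∃ c, f c x ≠ 0 ∧ ∀ d < c, f d x = 0) :
    IsCortege (Set.range f) fun g h =>
      (Equiv.ofInjective f hf).symm g ≤ (Equiv.ofInjective f hf).symm h := by
  set e := Equiv.ofInjective f hf
  have he (c : Γ) : ((e c : Set.range f) : X →ᵃ[ℝ] ℝ) = f c := rfl
  refine ⟨fun _ => le_rfl, fun _ _ _ => le_trans,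
    fun _ _ h h' => e.symm.injective (le_antisymm h h'), fun _ _ => le_total _ _,
    fun g => ⟨x₀, fun h _ _ => ?_⟩, fun g => ?_, fun x hx => ?_⟩
  · obtain ⟨c, rfl⟩ := e.surjective h
    exact hx₀ c
  · obtain ⟨c, rfl⟩ := e.surjective g
    obtain ⟨y, hy, hlt⟩ := hfirst c
    -- Earlier members vanish at `x₀` and `y`, hence on their line, where `f c` takes every real
    -- value.
    refine Set.eq_univ_of_forall fun r => ⟨AffineMap.lineMap x₀ y (r / f c y), ?_, ?_⟩
    · intro h hle hne
      obtain ⟨d, rfl⟩ := e.surjective h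
      have hdc : d < c := lt_of_le_of_ne (by simpa using hle) fun h => hne (h ▸ rfl)
      rw [he, AffineMap.apply_lineMap, hx₀, hlt d hdc, AffineMap.lineMap_same_apply]
    · rw [he, AffineMap.apply_lineMap, hx₀, AffineMap.lineMap_apply_module]
      simp [div_mul_cancel₀ _ hy]
  · obtain ⟨g, hg⟩ := hx
    obtain ⟨b, rfl⟩ := e.surjective g
    obtain ⟨c, hc, hlt⟩ := hleast x ⟨b, hg⟩
    refine ⟨e c, hc, fun h hh => ?_⟩
    obtain ⟨d, rfl⟩ := e.surjective h
    simp only [Equiv.symm_apply_apply]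
    exact not_lt.1 fun hdc => hh (hlt d hdc)

variable {V : Type*} [AddCommGroup V] [Module ℝ V]

/-- A linear map to a linearly ordered real vector space, translated so as to vanish at `x₀`, has
the same sign as some regular step-affine function. -/
theorem exists_isRegularStepAffine [LinearOrder V] [IsOrderedAddMonoid V] [IsOrderedModule ℝ V]
    (π : X →ₗ[ℝ] V) (hπ : Function.Surjective π) (x₀ : X) :
    ∃ u : X → ℝ, IsRegularStepAffine u ∧ (∀ x, 0 ≤ u x ↔ 0 ≤ π (x - x₀)) ∧
      ∀ x, u x = 0 ↔ π (x - x₀) = 0 := by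
  have := nonempty_seed_real (V := V)
  obtain ⟨φ, hφ, horder⟩ := hahnEmbedding_isOrderedModule (K := ℝ) (M := V) (R := ℝ)
  let ψ (x : X) : HahnSeries (FiniteArchimedeanClass V) ℝ := ofLex (φ (π (x - x₀)))
  let l (c : FiniteArchimedeanClass V) : X →ₗ[ℝ] ℝ :=
    { toFun := fun x => (ofLex (φ (π x))).coeff c
      map_add' := fun x y => by simp
      map_smul' := fun r x => by simp }
  let f (c : FiniteArchimedeanClass V) : X →ᵃ[ℝ] ℝ :=
    (l c).toAffineMap.comp (AffineMap.id ℝ X - AffineMap.const ℝ X x₀)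
  have hfψ (c x) : f c x = (ψ x).coeff c := rfl
  have hψ0 (x) : ψ x = 0 ↔ π (x - x₀) = 0 := by
    rw [← map_eq_zero_iff φ hφ.injective]; rfl
  -- A preimage of a representative `v` of the class `c` works: the order of the series `φ v` is the
  -- class of `v`.
  have hfirst (c) : ∃ y, f c y ≠ 0 ∧ ∀ d < c, f d y = 0 := by
    obtain ⟨v, hv, rfl⟩ : ∃ v, ∃ hv : v ≠ 0, c = FiniteArchimedeanClass.mk v hv := by
      induction c using FiniteArchimedeanClass.ind with
      | mk v hv => exact ⟨v, hv, rfl⟩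
    obtain ⟨y, hy⟩ := hπ v
    have hyv : ψ (y + x₀) = ofLex (φ v) := by simp [ψ, hy]
    have ho : (ψ (y + x₀)).orderTop = FiniteArchimedeanClass.mk v hv := by
      rw [hyv, ← FiniteArchimedeanClass.withTopOrderIso_symm_apply, horder,
        OrderIso.symm_apply_apply]
    exact ⟨y + x₀, coeff_orderTop_ne ho, fun d hd =>
      coeff_eq_zero_of_lt_orderTop (ho ▸ WithTop.coe_lt_coe.2 hd : _ < (ψ (y + x₀)).orderTop)⟩
  have hleast (x) (hx : ψ x ≠ 0) : ∃ c : FiniteArchimedeanClass V, (ψ x).orderTop = c :=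
    ⟨_, (WithTop.coe_untop _ (orderTop_ne_top.2 hx)).symm⟩
  have hinj : Function.Injective f := by
    intro c d hcd
    by_contra hne
    wlog h : c < d generalizing c d
    · exact this hcd.symm (Ne.symm hne) (lt_of_le_of_ne (not_lt.1 h) (Ne.symm hne))
    obtain ⟨y, hy, hlt⟩ := hfirst d
    exact hy (hcd ▸ hlt c h)
  have hx₀ (c) : f c x₀ = 0 := by simp [hfψ, ψ]
  refine ⟨fun x => (ψ x).leadingCoeff, ⟨⟨Set.range f, _,
    isCortege_range hinj x₀ hx₀ hfirst ?_, fun x => ⟨fun h => ?_, ?_⟩⟩, x₀, ?_⟩, fun x => ?_,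
      fun x => ?_⟩
  · rintro x ⟨c, hc⟩
    obtain ⟨b, hb⟩ := hleast x (ne_zero_of_coeff_ne_zero hc)
    exact ⟨b, coeff_orderTop_ne hb, fun d hd =>
      coeff_eq_zero_of_lt_orderTop (hb ▸ WithTop.coe_lt_coe.2 hd : _ < (ψ x).orderTop)⟩
  · rw [leadingCoeff_eq_zero]
    ext c
    exact h ⟨f c, c, rfl⟩
  · rintro ⟨_, c, rfl⟩ ⟨hc, hmin⟩
    obtain ⟨b, hb⟩ := hleast x (ne_zero_of_coeff_ne_zero hc)
    have hcb : c ≤ b := by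
      have := hmin ⟨f b, b, rfl⟩ (coeff_orderTop_ne hb)
      simpa using this
    have hbc : b ≤ c := WithTop.coe_le_coe.1 (hb ▸ orderTop_le_of_coeff_ne_zero hc)
    obtain rfl := le_antisymm hcb hbc
    simp [leadingCoeff, hb, hfψ]
  · simp [ψ]
  · rw [leadingCoeff_nonneg_iff, ← map_zero φ, hφ.le_iff_le]
  · rw [leadingCoeff_eq_zero, hψ0]

end Cortege

/-! ### Faces and their three descriptions -/

section Face

variable {X : Type*} [AddCommGroup X] [Module ℝ X] {Q F : Set X}

theorem exists_eq_smul_sub_of_mem_vectorSpan (hF : Convex ℝ F) (hne : F.Nonempty) {v : X}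
    (hv : v ∈ vectorSpan ℝ F) : ∃ t : ℝ, 0 < t ∧ ∃ a ∈ F, ∃ b ∈ F, v = t • (a - b) := by
  obtain ⟨z, hz⟩ := hne
  induction hv using Submodule.span_induction with
  | mem x hx =>
    obtain ⟨a, ha, b, hb, rfl⟩ := Set.mem_vsub.1 hx
    exact ⟨1, one_pos, a, ha, b, hb, by simp⟩
  | zero => exact ⟨1, one_pos, z, hz, z, hz, by simp⟩
  | add x y _ _ hx hy =>
    obtain ⟨s, hs, a, ha, b, hb, rfl⟩ := hx
    obtain ⟨t, ht, c, hc, d, hd, rfl⟩ := hy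
    have hst : 0 < s + t := add_pos hs ht
    have hmem {p q : X} (hp : p ∈ F) (hq : q ∈ F) :
        (s / (s + t)) • p + (t / (s + t)) • q ∈ F :=
      hF hp hq (by positivity) (by positivity) (by field_simp)
    refine ⟨s + t, hst, _, hmem ha hc, _, hmem hb hd, ?_⟩
    match_scalars <;> field_simp
  | smul c x _ hx =>
    obtain ⟨s, hs, a, ha, b, hb, rfl⟩ := hx
    rcases lt_trichotomy c 0 with h | rfl | h
    · exact ⟨-c * s, mul_pos (neg_pos.2 h) hs, b, hb, a, ha, by match_scalars <;> ring⟩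
    · exact ⟨1, one_pos, z, hz, z, hz, by simp⟩
    · exact ⟨c * s, mul_pos h hs, a, ha, b, hb, by rw [mul_smul]⟩

/-- If `q - x₀ = t • (a - b)` with `t > 0`, then `(q + t • b) / (1 + t) = (x₀ + t • a) / (1 + t)`.
The right side is in `F` by convexity, so the face property gives `q ∈ F`. -/
theorem IsFace.sub_mem_vectorSpan_iff (hF : IsFace Q F) {x₀ q : X} (hx₀ : x₀ ∈ F) (hq : q ∈ Q) :
    q - x₀ ∈ vectorSpan ℝ F ↔ q ∈ F := by
  refine ⟨fun h => ?_, fun h => vsub_mem_vectorSpan ℝ h hx₀⟩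
  obtain ⟨t, ht, a, ha, b, hb, hab⟩ := exists_eq_smul_sub_of_mem_vectorSpan hF.convex hF.nonempty h
  have ht1 : 0 < 1 + t := by positivity
  refine (hF.extreme q hq b (hF.subset hb) (1 / (1 + t)) (by positivity)
    ((div_lt_one ht1).2 (by linarith)) ?_).1
  have : (1 / (1 + t)) • q + (1 - 1 / (1 + t)) • b
      = (1 / (1 + t)) • x₀ + (t / (1 + t)) • a := by
    rw [sub_eq_iff_eq_add.1 hab]
    match_scalars <;> field_simp
    ring
  rw [this]
  exact hF.convex hx₀ ha (by positivity) (by positivity) (by field_simp)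

/-- A face is the set where a linear map to a linearly ordered vector space attains its minimum
on the convex set, the kernel of the map being the direction of the face. -/
theorem IsFace.exists_linearOrder_quotient (hQ : Convex ℝ Q) (hF : IsFace Q F) {x₀ : X}
    (hx₀ : x₀ ∈ F) :
    ∃ (_ : LinearOrder (X ⧸ vectorSpan ℝ F)) (_ : IsOrderedAddMonoid (X ⧸ vectorSpan ℝ F))
      (_ : IsOrderedModule ℝ (X ⧸ vectorSpan ℝ F)),
      ∀ q ∈ Q, 0 ≤ (vectorSpan ℝ F).mkQ (q - x₀) := by
  set π := (vectorSpan ℝ F).mkQ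
  have hA : Convex ℝ ((fun q => π (q - x₀)) '' Q) := by
    have := (hQ.translate (-x₀)).linear_image π
    rw [Set.image_image] at this
    simpa only [neg_add_eq_sub] using this
  obtain ⟨o, h₁, h₂, h⟩ := exists_linearOrder_of_zero_mem_extremePoints hA (by
    refine ⟨⟨x₀, hF.subset hx₀, by simp⟩, ?_⟩
    rintro _ ⟨p, hp, rfl⟩ _ ⟨q, hq, rfl⟩ ⟨s, t, hs, ht, hst, hsum⟩
    obtain rfl : t = 1 - s := by linarith
    have hw : s • p + (1 - s) • q ∈ F := by
      rw [← hF.sub_mem_vectorSpan_iff hx₀ (hQ hp hq hs.le ht.le hst),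
        ← Submodule.Quotient.mk_eq_zero, ← Submodule.mkQ_apply, ← hsum, ← map_smul, ← map_smul,
        ← map_add]
      congr 1
      module
    have := (hF.extreme p hp q hq s hs (by linarith) hw).1
    exact (Submodule.Quotient.mk_eq_zero _).2 ((hF.sub_mem_vectorSpan_iff hx₀ hp).2 this))
  exact ⟨o, h₁, h₂, fun q hq => h _ ⟨q, hq, rfl⟩⟩

theorem isGeneralizedSemispace_of_pos {V : Type*} [AddCommGroup V] [Module ℝ V] [LinearOrder V]
    [IsOrderedAddMonoid V] [IsOrderedModule ℝ V] (π : X →ₗ[ℝ] V) {M : AffineSubspace ℝ X} {x₀ : X}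
    (hM : ∀ x, x ∈ M ↔ π (x - x₀) = 0) :
    IsGeneralizedSemispace M {x | 0 < π (x - x₀)} := by
  refine ⟨⟨?_, fun x hx hxM => hx.ne' ((hM x).1 hxM)⟩, fun C ⟨hC, hCM⟩ hle c hc => ?_⟩
  · have : PosSMulStrictMono ℝ V := PosSMulMono.toPosSMulStrictMono
    have hconv := ((convex_Ioi (𝕜 := ℝ) (0 : V)).linear_preimage π).translate_preimage_left (-x₀)
    simp only [← sub_eq_add_neg] at hconv
    exact hconv
  · by_contra hneg
    have hlt : π (c - x₀) < 0 :=
      lt_of_le_of_ne (not_lt.1 hneg) fun h => hCM hc ((hM c).2 h)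
    -- Maximality: the reflection of `c` in `x₀` is on the positive side, and the midpoint `x₀` lies
    -- in `M`.
    have hrefl : (2 : ℝ) • x₀ - c ∈ C := hle (by
      have : (2 : ℝ) • x₀ - c - x₀ = -(c - x₀) := by module
      simpa only [Set.mem_ofPred_eq, this, map_neg, neg_pos] using hlt)
    refine hCM (hC hc hrefl (a := 1 / 2) (b := 1 / 2) (by norm_num) (by norm_num) (by norm_num)) ?_
    have : (1 / 2 : ℝ) • c + (1 / 2 : ℝ) • ((2 : ℝ) • x₀ - c) = x₀ := by module
    rw [this]
    exact (hM x₀).2 (by simp)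

theorem isCompatibleTotalPreorder_of_linearMap {V : Type*} [AddCommGroup V] [Module ℝ V]
    [LinearOrder V] [IsOrderedAddMonoid V] [IsOrderedModule ℝ V] (π : X →ₗ[ℝ] V) :
    IsCompatibleTotalPreorder fun x y => π x ≤ π y where
  refl _ := le_rfl
  trans _ _ _ := le_trans
  add_right x y z h := by simpa using h
  smul x y c hc h := by simpa using smul_le_smul_of_nonneg_left h hc.le
  total _ _ := le_total _ _

theorem isFace_inter_of_subset_union {M : AffineSubspace ℝ X} {S : Set X} (hQ : Convex ℝ Q)
    (hS : Convex ℝ S) (hSM : S ⊆ (M : Set X)ᶜ) (hQS : Q ⊆ S ∪ M)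
    (hne : (Q ∩ (M : Set X)).Nonempty) : IsFace Q (Q ∩ (M : Set X)) := by
  refine ⟨hne, hQ.inter M.convex, Set.inter_subset_left, ?_⟩
  have key : ∀ u ∈ Q, ∀ v ∈ Q, ∀ α : ℝ, 0 < α → α < 1 → α • u + (1 - α) • v ∈ M → u ∈ M := by
    intro u hu v hv α h0 h1 hw
    by_contra huM
    have huS : u ∈ S := (hQS hu).resolve_right huM
    rcases hQS hv with hvS | hvM
    · exact hSM (hS huS hvS h0.le (by linarith) (by ring)) hw
    · refine huM ?_
      -- The line through `v` and the interior point, both in `M`, reaches `u` at parameter `1 / α`.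
      have := AffineMap.lineMap_mem (Q := M) (1 / α) hvM hw
      convert this using 1
      rw [AffineMap.lineMap_apply_module]
      match_scalars <;> field_simp
      ring
  intro u hu v hv α h0 h1 hw
  exact ⟨⟨hu, key u hu v hv α h0 h1 hw.2⟩, hv,
    key v hv u hu (1 - α) (by linarith) (by linarith) (by simpa [add_comm] using hw.2)⟩

theorem IsCompatibleTotalPreorder.isFace_minSet {r : X → X → Prop}
    (hr : IsCompatibleTotalPreorder r) (hQ : Convex ℝ Q) (hne : (minSet Q r).Nonempty) :
    IsFace Q (minSet Q r) := by
  have hadd {a b c d : X} (h : r a b) (h' : r c d) : r (a + c) (b + d) :=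
    hr.trans _ _ _ (hr.add_right _ _ c h)
      (by simpa only [add_comm b] using hr.add_right _ _ b h')
  have hcomb {s t : ℝ} (hs : 0 < s) (ht : 0 < t) {a b c d : X} (h : r a b) (h' : r c d) :
      r (s • a + t • c) (s • b + t • d) := hadd (hr.smul _ _ _ hs h) (hr.smul _ _ _ ht h')
  refine ⟨hne, ?_, fun x hx => hx.1, ?_⟩
  · refine convex_iff_forall_pos.2 fun x hx y hy s t hs ht hst =>
      ⟨hQ hx.1 hy.1 hs.le ht.le hst, fun z hz => ?_⟩
    have := hcomb hs ht (hx.2 z hz) (hy.2 z hz)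
    rwa [← add_smul, hst, one_smul] at this
  have key : ∀ u ∈ Q, ∀ v ∈ Q, ∀ α : ℝ, 0 < α → α < 1 →
      α • u + (1 - α) • v ∈ minSet Q r → u ∈ minSet Q r := by
    intro u hu v hv α h0 h1 ⟨_, hw⟩
    set w := α • u + (1 - α) • v with hwdef
    have h1' : 0 < 1 - α := by linarith
    -- From `w ⪯ v`, cancelling `(1 - α) • w` and adding `α • u` gives `α • u ⪯ α • w`.
    have huw : r u w := by
      have h := hr.add_right _ _ (-((1 - α) • w)) (hr.smul _ _ _ h1' (hw v hv))
      have h' := hr.add_right _ _ (α • u) h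
      have h'' := hr.smul _ _ α⁻¹ (inv_pos.2 h0)
        (by simpa only [add_neg_cancel, zero_add] using h')
      convert h'' using 1
      · rw [inv_smul_smul₀ h0.ne']
      · have : (1 - α) • v + -((1 - α) • w) + α • u = α • w := by
          have : (1 - α) • v = w - α • u := by rw [hwdef]; abel
          rw [this]; module
        rw [this, inv_smul_smul₀ h0.ne']
    exact ⟨hu, fun y hy => hr.trans _ _ _ huw (hw y hy)⟩
  intro u hu v hv α h0 h1 hw
  exact ⟨key u hu v hv α h0 h1 hw,
    key v hv u hu (1 - α) (by linarith) (by linarith) (by simpa [add_comm] using hw)⟩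

theorem IsStepAffine.isFace_zeros {u : X → ℝ} (hu : IsStepAffine u) (hQ : Convex ℝ Q)
    (hnonneg : ∀ x ∈ Q, 0 ≤ u x) (hne : {x | x ∈ Q ∧ u x = 0}.Nonempty) :
    IsFace Q {x | x ∈ Q ∧ u x = 0} := by
  obtain ⟨𝓕, le, hc, hval⟩ := hu
  have hzero (x) : u x = 0 ↔ ∀ f : 𝓕, (f : X →ᵃ[ℝ] ℝ) x = 0 := by
    refine ⟨fun h => ?_, (hval x).1⟩
    by_contra! hex
    obtain ⟨f, hf⟩ := hc.exists_least x hex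
    exact hf.1 ((hval x).2 f hf ▸ h)
  have happ (f : X →ᵃ[ℝ] ℝ) {s t : ℝ} (hst : s + t = 1) (x y : X) :
      f (s • x + t • y) = s * f x + t * f y := by
    simpa using Convex.combo_affine_apply (f := f) hst
  refine ⟨hne, ?_, fun x hx => hx.1, ?_⟩
  · intro x hx y hy s t hs ht hst
    refine ⟨hQ hx.1 hy.1 hs ht hst, (hzero _).2 fun f => ?_⟩
    rw [happ f hst, (hzero x).1 hx.2 f, (hzero y).1 hy.2 f]
    simp
  have hpos {x} (hx : x ∈ Q) {f} (hf : IsLeastNonzeroAt 𝓕 le x f) : 0 < (f : X →ᵃ[ℝ] ℝ) x :=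
    lt_of_le_of_ne ((hval x).2 f hf ▸ hnonneg x hx) (Ne.symm hf.1)
  have hnonneg_of_le {x} (hx : x ∈ Q) {f g} (hf : IsLeastNonzeroAt 𝓕 le x f) (hgf : le g f) :
      0 ≤ (g : X →ᵃ[ℝ] ℝ) x := by
    by_cases hg : (g : X →ᵃ[ℝ] ℝ) x = 0
    · exact hg.ge
    · rw [hc.le_antisymm g f hgf (hf.2 g hg)]
      exact (hpos hx hf).le
  have key : ∀ p ∈ Q, ∀ q ∈ Q, ∀ α : ℝ, 0 < α → α < 1 → u (α • p + (1 - α) • q) = 0 →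
      u p = 0 := by
    intro p hp q hq α h0 h1 hw
    rw [hzero] at hw ⊢
    by_contra! hex
    obtain ⟨f, hf⟩ := hc.exists_least p hex
    have h1' : 0 < 1 - α := by linarith
    have hfp := hpos hp hf
    have hwf (g : 𝓕) : α * (g : X →ᵃ[ℝ] ℝ) p + (1 - α) * (g : X →ᵃ[ℝ] ℝ) q = 0 := by
      rw [← happ g (by ring)]; exact hw g
    -- The first nonzero member `f` at `p` is positive there, hence negative at `q`. So the first
    -- nonzero member `g` at `q` precedes `f`; it is positive at `q` and nonnegative at `p`, and
    -- cannot vanish in between.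
    have hfq : (f : X →ᵃ[ℝ] ℝ) q < 0 := by
      have := hwf f
      have := mul_pos h0 hfp
      by_contra! h
      have := mul_nonneg h1'.le h
      linarith
    obtain ⟨g, hg⟩ := hc.exists_least q ⟨f, hfq.ne⟩
    have h2 := mul_pos h1' (hpos hq hg)
    have h3 := mul_nonneg h0.le (hnonneg_of_le hp hf (hg.2 f hfq.ne))
    have := hwf g
    linarith
  intro p hp q hq α h0 h1 hw
  exact ⟨⟨hp, key p hp q hq α h0 h1 hw.2⟩, hq,
    key q hq p hp (1 - α) (by linarith) (by linarith) (by simpa [add_comm] using hw.2)⟩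

end Face

end ConvexFace

/-! ### The equivalence -/

open ConvexFace in
theorem theorem4 {X : Type*} [AddCommGroup X] [Module ℝ X] (Q : Set X) (hQ : Convex ℝ Q)
    (F : Set X) (hFQ : F ⊆ Q) (hF_nonempty : F.Nonempty) (hF_ne : F ≠ Q) :
    List.TFAE [
      ConvexFace.IsProperFace Q F,
      ∃ (M : AffineSubspace ℝ X) (S : Set X), ConvexFace.IsGeneralizedSemispace M S ∧
        Q ⊆ S ∪ (M : Set X) ∧ F = Q ∩ (M : Set X),
      ∃ r : X → X → Prop, ConvexFace.IsCompatibleTotalPreorder r ∧ F = ConvexFace.minSet Q r,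
      ∃ u : X → ℝ, ConvexFace.IsRegularStepAffine u ∧ (∀ x ∈ Q, 0 ≤ u x) ∧
        F = {x | x ∈ Q ∧ u x = 0}] := by
  obtain ⟨x₀, hx₀⟩ := hF_nonempty
  tfae_have 1 → 2 := by
    rintro ⟨hF, -⟩
    obtain ⟨o, h₁, h₂, hnonneg⟩ := hF.exists_linearOrder_quotient hQ hx₀
    have hM (x) : x ∈ AffineSubspace.mk' x₀ (vectorSpan ℝ F) ↔
        (vectorSpan ℝ F).mkQ (x - x₀) = 0 := by
      rw [AffineSubspace.mem_mk', Submodule.mkQ_apply, Submodule.Quotient.mk_eq_zero, vsub_eq_sub]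
    refine ⟨AffineSubspace.mk' x₀ (vectorSpan ℝ F), _, isGeneralizedSemispace_of_pos _ hM,
      fun q hq => ?_, ?_⟩
    · rcases (hnonneg q hq).lt_or_eq with h | h
      · exact Or.inl h
      · exact Or.inr ((hM q).2 h.symm)
    · ext q
      refine ⟨fun h => ⟨hFQ h, ?_⟩, fun ⟨hq, h⟩ => ?_⟩
      · exact (hF.sub_mem_vectorSpan_iff hx₀ (hFQ h)).2 h
      · exact (hF.sub_mem_vectorSpan_iff hx₀ hq).1 h
  tfae_have 1 → 3 := by
    rintro ⟨hF, -⟩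
    obtain ⟨o, h₁, h₂, hnonneg⟩ := hF.exists_linearOrder_quotient hQ hx₀
    refine ⟨_, isCompatibleTotalPreorder_of_linearMap (vectorSpan ℝ F).mkQ, ?_⟩
    ext q
    refine ⟨fun h => ⟨hFQ h, fun y hy => ?_⟩, fun ⟨hq, h⟩ => ?_⟩
    · have h0 := (hF.sub_mem_vectorSpan_iff hx₀ (hFQ h)).2 h
      rw [← Submodule.Quotient.mk_eq_zero, ← Submodule.mkQ_apply, map_sub, sub_eq_zero] at h0
      change (vectorSpan ℝ F).mkQ q ≤ (vectorSpan ℝ F).mkQ y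
      rw [h0, ← sub_nonneg, ← map_sub]
      exact hnonneg y hy
    · rw [← hF.sub_mem_vectorSpan_iff hx₀ hq, ← Submodule.Quotient.mk_eq_zero,
        ← Submodule.mkQ_apply]
      refine le_antisymm ?_ (hnonneg q hq)
      rw [map_sub, sub_nonpos]
      exact h x₀ (hFQ hx₀)
  tfae_have 1 → 4 := by
    rintro ⟨hF, -⟩
    obtain ⟨o, h₁, h₂, hnonneg⟩ := hF.exists_linearOrder_quotient hQ hx₀
    obtain ⟨u, hu, hu_nonneg, hu_zero⟩ :=
      exists_isRegularStepAffine _ (vectorSpan ℝ F).mkQ_surjective x₀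
    refine ⟨u, hu, fun x hx => (hu_nonneg x).2 (hnonneg x hx), ?_⟩
    ext q
    simp only [Set.mem_ofPred_eq, hu_zero, Submodule.mkQ_apply, Submodule.Quotient.mk_eq_zero]
    exact ⟨fun h => ⟨hFQ h, (hF.sub_mem_vectorSpan_iff hx₀ (hFQ h)).2 h⟩,
      fun ⟨hq, h⟩ => (hF.sub_mem_vectorSpan_iff hx₀ hq).1 h⟩
  tfae_have 2 → 1 := by
    rintro ⟨M, S, ⟨⟨hS, hSM⟩, -⟩, hQS, rfl⟩
    exact ⟨isFace_inter_of_subset_union hQ hS hSM hQS ⟨x₀, hx₀⟩, hF_ne⟩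
  tfae_have 3 → 1 := by
    rintro ⟨r, hr, rfl⟩
    exact ⟨hr.isFace_minSet hQ ⟨x₀, hx₀⟩, hF_ne⟩
  tfae_have 4 → 1 := by
    rintro ⟨u, hu, hnonneg, rfl⟩
    exact ⟨hu.1.isFace_zeros hQ hnonneg ⟨x₀, hx₀⟩, hF_ne⟩
  tfae_finish
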